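/- Let $(\Omega,\mathcal F,\mathbb F=(\mathcal F_t)_{t\ge 0},\mathbb P)$ be a filtered probability space satisfying the usual conditions and carrying a standard one-dimensional $\mathbb F$-Brownian motion $W$. Fix constants $\kappa,\sigma,\beta,\rho>0$, $\mu\in\mathbb R$, $c\ge 0$ and $\bar y\ge 0$. For $y\in[0,\bar y]$ let $\mathcal I^{\bar y}(y)$ be the set of $\mathbb F$-adapted processes $I=(I_t)_{t\ge0}$ with values in $[0,\infty)$ whose paths are a.s. nondecreasing and càdlàg with $I_t\le\bar y-y$ for all $t\ge 0$, and put $I_{0-}:=0$. For $x\in\mathbb R$ and $I\in\mathcal I^{\bar y}(y)$ let $X^{x,y,I}$ be the (up to indistinguishability unique) continuous adapted solution of $$dX_t=\kappa\big((\mu-\beta(y+I_t))-X_t\big)\,dt+\sigma\,dW_t,\qquad X_{0-}=x,$$ and let $$\mathcal J(x,y,I):=\mathbb E\bigg[\int_0^\infty e^{-\rho t}X^{x,y,I}_t\,(y+I_t)\,dt-c\int_{[0,\infty)}e^{-\rho t}\,dI_t\bigg],\qquad V(x,y):=\sup_{I\in\mathcal I^{\bar y}(y)}\mathcal J(x,y,I),$$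 where the second integral includes the possible jump of $I$ at time $0$. Let $I^0\equiv 0$ and $$R(x,y):=\mathcal J(x,y,I^0)=\frac{xy}{\rho+\kappa}+\frac{\mu\kappa y}{\rho(\rho+\kappa)}-\frac{\kappa\beta y^2}{\rho(\rho+\kappa)}.$$ Then all of these objects are well defined (the equation for $X^{x,y,I}$ is uniquely solvable, the integrals and expectations converge, the supremum is finite, and $R$ has the displayed explicit form), and: (i) there exists a constant $K>0$ such that $|V(x,y)|\le K(1+|x|)$ for all $(x,y)\in\mathbb R\times[0,\bar y]$; (ii) $V(x,\bar y)=R(x,\bar y)$ for all $x\in\mathbb R$; (iii) for every $y\in[0,\bar y]$ the function $x\mapsto V(x,y)$ is nondecreasing on $\mathbb R$. -/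

import Mathlib

open MeasureTheory ProbabilityTheory Set Filter Topology
open scoped NNReal

/-- The usual conditions: `𝓕` is right-continuous and `𝓕 0` contains every `P`-null set (so in
particular `P` is complete). -/
structure UsualConditions {Ω : Type*} {mΩ : MeasurableSpace Ω} (P : Measure Ω)
    (𝓕 : Filtration ℝ≥0 mΩ) : Prop where
  right_continuous : 𝓕.IsRightContinuous
  null_mem : ∀ s : Set Ω, P s = 0 → MeasurableSet[𝓕 0] s

/-- `W` is a standard one-dimensional `𝓕`-Brownian motion: a Brownian motion (started at `0`, with
almost surely continuous paths) that is adapted to `𝓕` and whose increments after time `s` are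
independent of `𝓕 s`. -/
structure IsFBrownian {Ω : Type*} {mΩ : MeasurableSpace Ω} (P : Measure Ω)
    (𝓕 : Filtration ℝ≥0 mΩ) (W : ℝ≥0 → Ω → ℝ) : Prop where
  brownian : IsBrownianReal W P
  adapted : StronglyAdapted 𝓕 W
  indep_increment : ∀ s t : ℝ≥0, s ≤ t →
    Indep (MeasurableSpace.comap (fun ω => W t ω - W s ω) inferInstance) (𝓕 s) P

/-- The parameters: mean-reversion speed `κ`, mean-reversion level `μ`, volatility `σ`, price impact
`β`, discount rate `ρ`, proportional installation cost `c`, and maximal installed power `ybar`. -/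
structure Params where
  κ : ℝ
  μ : ℝ
  σ : ℝ
  β : ℝ
  ρ : ℝ
  c : ℝ
  ybar : ℝ

/-- The admissible installation strategies for initial installed power `y`: adapted nonnegative
processes whose paths are almost surely nondecreasing, càdlàg and bounded by `ybar - y`.
The convention `I_{0-} = 0` enters through `discountedInstallation`. -/
structure Admissible {Ω : Type*} {mΩ : MeasurableSpace Ω} (P : Measure Ω)
    (𝓕 : Filtration ℝ≥0 mΩ) (p : Params) (y : ℝ) (I : ℝ≥0 → Ω → ℝ) : Prop where
  adapted : StronglyAdapted 𝓕 I
  nonneg : ∀ t ω, 0 ≤ I t ω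
  monotone : ∀ᵐ ω ∂P, Monotone fun t => I t ω
  cadlag : ∀ᵐ ω ∂P, ∀ t : ℝ≥0, ContinuousWithinAt (fun s => I s ω) (Ici t) t ∧
    ∃ l : ℝ, Tendsto (fun s => I s ω) (𝓝[<] t) (𝓝 l)
  le_capacity : ∀ᵐ ω ∂P, ∀ t, I t ω ≤ p.ybar - y

/-- `X` is a (strong) solution of
`dX_t = κ ((μ - β (y + I_t)) - X_t) dt + σ dW_t`, `X_{0-} = x`: an adapted process with
almost surely continuous paths that satisfies the integrated equation. The noise is additive, so
the stochastic integral of the constant `σ` is `σ W_t`. -/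
structure IsPrice {Ω : Type*} {mΩ : MeasurableSpace Ω} (P : Measure Ω)
    (𝓕 : Filtration ℝ≥0 mΩ) (W : ℝ≥0 → Ω → ℝ) (p : Params) (x y : ℝ)
    (I X : ℝ≥0 → Ω → ℝ) : Prop where
  adapted : StronglyAdapted 𝓕 X
  continuous : ∀ᵐ ω ∂P, Continuous fun t => X t ω
  equation : ∀ᵐ ω ∂P, ∀ t : ℝ≥0,
    X t ω = x + (∫ s in (0 : ℝ)..t,
      p.κ * ((p.μ - p.β * (y + I s.toNNReal ω)) - X s.toNNReal ω)) + p.σ * W t ω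

open Classical in
/-- The price process `X^{x,y,I}`: the solution of its stochastic differential equation
(and the zero process if there is none). -/
noncomputable def price {Ω : Type*} {mΩ : MeasurableSpace Ω} (P : Measure Ω)
    (𝓕 : Filtration ℝ≥0 mΩ) (W : ℝ≥0 → Ω → ℝ) (p : Params) (x y : ℝ)
    (I : ℝ≥0 → Ω → ℝ) : ℝ≥0 → Ω → ℝ :=
  if h : ∃ X, IsPrice P 𝓕 W p x y I X then h.choose else 0

/-- A path on `[0, ∞)`, extended to negative times by the value `0`. -/
noncomputable def extendByZero (f : ℝ≥0 → ℝ) (t : ℝ) : ℝ :=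
  if t < 0 then 0 else f t.toNNReal

open Classical in
/-- The Lebesgue-Stieltjes measure `df` on `ℝ` of a nondecreasing path `f ≥ 0` with `f_{0-} = 0`;
it has an atom of mass `f 0` at time `0`. (It is `0` if the extended path is not nondecreasing.) -/
noncomputable def pathMeasure (f : ℝ≥0 → ℝ) : Measure ℝ :=
  if h : Monotone (extendByZero f) then h.stieltjesFunction.measure else 0

/-- `∫_{[0,∞)} e^{-ρ t} df_t`, a possible jump of `f` at time `0` included. -/
noncomputable def discountedInstallation (ρ : ℝ) (f : ℝ≥0 → ℝ) : ℝ :=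
  ∫ t in Ici (0 : ℝ), Real.exp (-ρ * t) ∂(pathMeasure f)

/-- The discounted running revenue `e^{-ρ t} X_t^{x,y,I} (y + I_t)` at time `t`. -/
noncomputable def revenueRate {Ω : Type*} {mΩ : MeasurableSpace Ω} (P : Measure Ω)
    (𝓕 : Filtration ℝ≥0 mΩ) (W : ℝ≥0 → Ω → ℝ) (p : Params) (x y : ℝ)
    (I : ℝ≥0 → Ω → ℝ) (ω : Ω) (t : ℝ) : ℝ :=
  Real.exp (-p.ρ * t) * price P 𝓕 W p x y I t.toNNReal ω * (y + I t.toNNReal ω)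

/-- The pathwise net profit
`∫_0^∞ e^{-ρ t} X_t^{x,y,I} (y + I_t) dt - c ∫_0^∞ e^{-ρ t} dI_t`. -/
noncomputable def netProfit {Ω : Type*} {mΩ : MeasurableSpace Ω} (P : Measure Ω)
    (𝓕 : Filtration ℝ≥0 mΩ) (W : ℝ≥0 → Ω → ℝ) (p : Params) (x y : ℝ)
    (I : ℝ≥0 → Ω → ℝ) (ω : Ω) : ℝ :=
  (∫ t in Ioi (0 : ℝ), revenueRate P 𝓕 W p x y I ω t) -
    p.c * discountedInstallation p.ρ fun t => I t ω

/-- The performance criterion `𝒥(x, y, I)`. -/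
noncomputable def expectedProfit {Ω : Type*} {mΩ : MeasurableSpace Ω} (P : Measure Ω)
    (𝓕 : Filtration ℝ≥0 mΩ) (W : ℝ≥0 → Ω → ℝ) (p : Params) (x y : ℝ)
    (I : ℝ≥0 → Ω → ℝ) : ℝ :=
  ∫ ω, netProfit P 𝓕 W p x y I ω ∂P

/-- The values `𝒥(x, y, I)` over all admissible strategies `I`. -/
def attainableProfits {Ω : Type*} {mΩ : MeasurableSpace Ω} (P : Measure Ω)
    (𝓕 : Filtration ℝ≥0 mΩ) (W : ℝ≥0 → Ω → ℝ) (p : Params) (x y : ℝ) : Set ℝ :=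
  {j | ∃ I, Admissible P 𝓕 p y I ∧ j = expectedProfit P 𝓕 W p x y I}

/-- The value function `V(x, y) = sup_I 𝒥(x, y, I)`. -/
noncomputable def valueFn {Ω : Type*} {mΩ : MeasurableSpace Ω} (P : Measure Ω)
    (𝓕 : Filtration ℝ≥0 mΩ) (W : ℝ≥0 → Ω → ℝ) (p : Params) (x y : ℝ) : ℝ :=
  sSup (attainableProfits P 𝓕 W p x y)

/-- The expected profit `R(x, y) = 𝒥(x, y, 0)` of the non-installation strategy. -/
noncomputable def noInstallProfit {Ω : Type*} {mΩ : MeasurableSpace Ω} (P : Measure Ω)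
    (𝓕 : Filtration ℝ≥0 mΩ) (W : ℝ≥0 → Ω → ℝ) (p : Params) (x y : ℝ) : ℝ :=
  expectedProfit P 𝓕 W p x y 0

/-- `𝒥(x, y, I)` is well defined: the price equation has a solution, unique up to
indistinguishability (and `price` is it), and all integrals that occur converge. -/
structure ProfitWellDefined {Ω : Type*} {mΩ : MeasurableSpace Ω} (P : Measure Ω)
    (𝓕 : Filtration ℝ≥0 mΩ) (W : ℝ≥0 → Ω → ℝ) (p : Params) (x y : ℝ)
    (I : ℝ≥0 → Ω → ℝ) : Prop where
  isPrice : IsPrice P 𝓕 W p x y I (price P 𝓕 W p x y I)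
  unique : ∀ X, IsPrice P 𝓕 W p x y I X → ∀ᵐ ω ∂P, ∀ t, X t ω = price P 𝓕 W p x y I t ω
  revenue : ∀ᵐ ω ∂P, IntegrableOn (revenueRate P 𝓕 W p x y I ω) (Ioi 0)
  monotone_path : ∀ᵐ ω ∂P, Monotone (extendByZero fun t => I t ω)
  cost : ∀ᵐ ω ∂P, IntegrableOn (fun t => Real.exp (-p.ρ * t)) (Ici 0)
    (pathMeasure fun t => I t ω)
  expectation : Integrable (netProfit P 𝓕 W p x y I) P

/-! The noise is additive, so no stochastic calculus is needed: path by path, `X - σ W` solves a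
linear equation `Y' = g - κ Y` whose forcing `g` depends only on the installation and noise paths.
Variation of constants makes the price an explicit functional `pricePath` of these two paths, and
Grönwall gives uniqueness (`IsForcing.eq_linearFlow`).

All claims are read off from this functional. Changing the initial value from `x` to `x'` adds `exp
(-κ t) * (x' - x)`, and `y + I ≥ 0`, so each strategy's profit is nondecreasing in `x`; a supremum
over a strategy set not involving `x` inherits this. The price is bounded by `|x|` plus a functional
of the noise alone, whose mean grows quadratically in time because `E|W_t| ≤ 1 + t`. Discounting
makes it integrable, while the installation cost is bounded through integration by parts. The
resulting linear bound is uniform over strategies (`exists_abs_expectedProfit_le`), so the supremum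
is finite and grows linearly. At `y = ybar` the capacity constraint forces `I = 0`. The formula for
`R` follows from Fubini and the mean price `integral_pricePath_zero`.

Path properties hold only almost surely. Since null sets lie in `𝓕 0`, processes can be set to zero
on the bad set without losing adaptedness (`exists_modification`); right-continuity then supplies
joint measurability. -/

/-! ### The linear equation with right-continuous forcing -/

/-- The variation-of-constants formula for `Y' = g - k Y`, `Y 0 = x`. -/
noncomputable def linearFlow (k x : ℝ) (g : ℝ → ℝ) (t : ℝ) : ℝ :=
  Real.exp (-k * t) * (x + ∫ s in (0 : ℝ)..t, Real.exp (k * s) * g s)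

/-- A forcing term for which the linear equation is solved by `linearFlow`. -/
structure IsForcing (g : ℝ → ℝ) : Prop where
  measurable : Measurable g
  intervalIntegrable : ∀ a b : ℝ, IntervalIntegrable g volume a b
  rightContinuous : ∀ t, ContinuousWithinAt g (Ici t) t

theorem IsForcing.exp_mul {g : ℝ → ℝ} (hg : IsForcing g) (k a b : ℝ) :
    IntervalIntegrable (fun s => Real.exp (k * s) * g s) volume a b :=
  (hg.intervalIntegrable a b).continuousOn_mul (by fun_prop)

theorem IsForcing.continuous_linearFlow {g : ℝ → ℝ} (hg : IsForcing g) (k x : ℝ) :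
    Continuous (linearFlow k x g) := by
  have := intervalIntegral.continuous_primitive (μ := volume) (hg.exp_mul k) 0
  unfold linearFlow
  fun_prop

/-- Only a right derivative is available, as the forcing may jump; it suffices for the fundamental
theorem of calculus. -/
theorem IsForcing.hasDerivWithinAt_linearFlow {g : ℝ → ℝ} (hg : IsForcing g) (k x t : ℝ) :
    HasDerivWithinAt (linearFlow k x g) (g t - k * linearFlow k x g t) (Ici t) t := by
  have h1 : HasDerivWithinAt (fun u => ∫ s in (0 : ℝ)..u, Real.exp (k * s) * g s)
      (Real.exp (k * t) * g t) (Ici t) t := by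
    refine intervalIntegral.integral_hasDerivWithinAt_right (t := Ioi t) (hg.exp_mul k 0 t)
      ?_ ?_
    · have hm : Measurable fun s => Real.exp (k * s) * g s := by
        have := hg.measurable
        fun_prop
      exact hm.stronglyMeasurable.stronglyMeasurableAtFilter
    · have h := (hg.rightContinuous t).mono Ioi_subset_Ici_self
      exact ContinuousWithinAt.mul (by fun_prop) h
  have h2 : HasDerivAt (fun u => Real.exp (-k * u)) (Real.exp (-k * t) * -k) t := by
    simpa using ((hasDerivAt_id t).const_mul (-k)).exp
  have h3 := h2.hasDerivWithinAt (s := Ici t) |>.mul (h1.const_add x)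
  refine h3.congr_deriv ?_
  have he : Real.exp (-k * t) * Real.exp (k * t) = 1 := by
    rw [← Real.exp_add]; simp
  simp only [linearFlow]
  linear_combination (g t) * he

theorem IsForcing.linearFlow_eq {g : ℝ → ℝ} (hg : IsForcing g) (k x t : ℝ) :
    linearFlow k x g t = x + ∫ s in (0 : ℝ)..t, (g s - k * linearFlow k x g s) := by
  rw [intervalIntegral.integral_eq_sub_of_hasDeriv_right (f := linearFlow k x g)]
  · simp [linearFlow]
  · exact (hg.continuous_linearFlow k x).continuousOn
  · exact fun s _ => (hg.hasDerivWithinAt_linearFlow k x s).mono Ioi_subset_Ici_self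
  · exact (hg.intervalIntegrable 0 t).sub
      (((hg.continuous_linearFlow k x).const_mul k).intervalIntegrable _ _)

/-- Grönwall is applied to the primitive `H`, which is differentiable everywhere; the equation for
`h` is known only at nonnegative times. -/
theorem eq_zero_of_eq_integral {h : ℝ → ℝ} (hc : Continuous h) (k : ℝ)
    (heq : ∀ t, 0 ≤ t → h t = ∫ s in (0 : ℝ)..t, -k * h s) (t : ℝ) (ht : 0 ≤ t) : h t = 0 := by
  set H : ℝ → ℝ := fun t => ∫ s in (0 : ℝ)..t, -k * h s with hH
  have hd : ∀ s, HasDerivAt H (-k * h s) s := fun s =>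
    intervalIntegral.integral_hasDerivAt_right ((hc.const_mul _).intervalIntegrable _ _)
      ((hc.const_mul _).stronglyMeasurableAtFilter _ _) (hc.const_mul _).continuousAt
  have := norm_le_gronwallBound_of_norm_deriv_right_le (f := H) (f' := fun s => -k * h s)
    (δ := 0) (K := |k|) (ε := 0) (a := 0) (b := t)
    (fun s _ => (hd s).continuousAt.continuousWithinAt) (fun s _ => (hd s).hasDerivWithinAt)
    (by simp [hH]) (fun s hs => by
      simp only [Real.norm_eq_abs, abs_mul, abs_neg, add_zero, hH, ← heq s hs.1, le_refl])
    t ⟨ht, le_rfl⟩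
  rw [gronwallBound_ε0_δ0] at this
  rw [heq t ht]
  exact norm_le_zero_iff.1 this

/-- The variation-of-constants solution is the only continuous one. -/
theorem IsForcing.eq_linearFlow {g Y : ℝ → ℝ} (hg : IsForcing g) (hY : Continuous Y) (k x : ℝ)
    (heq : ∀ t, 0 ≤ t → Y t = x + ∫ s in (0 : ℝ)..t, (g s - k * Y s)) (t : ℝ) (ht : 0 ≤ t) :
    Y t = linearFlow k x g t := by
  have hL := hg.continuous_linearFlow k x
  refine sub_eq_zero.1 (eq_zero_of_eq_integral (hY.sub hL) k (fun t ht => ?_) t ht)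
  rw [Pi.sub_apply, heq t ht, hg.linearFlow_eq k x t, add_sub_add_left_eq_sub,
    ← intervalIntegral.integral_sub]
  · congr 1 with s
    simp only [Pi.sub_apply]
    ring
  · exact (hg.intervalIntegrable 0 t).sub ((hY.const_mul k).intervalIntegrable _ _)
  · exact (hg.intervalIntegrable 0 t).sub ((hL.const_mul k).intervalIntegrable _ _)

theorem linearFlow_add_initial (k x x' : ℝ) (g : ℝ → ℝ) (t : ℝ) :
    linearFlow k x' g t = linearFlow k x g t + Real.exp (-k * t) * (x' - x) := by
  simp only [linearFlow]; ring

/-- The kernel `exp (-k * (t - s))` is at most `1` for `0 ≤ s ≤ t`. -/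
theorem IsForcing.abs_linearFlow_le {g b : ℝ → ℝ} (hg : IsForcing g)
    (hb : ∀ a c : ℝ, IntervalIntegrable b volume a c) (hgb : ∀ s, |g s| ≤ b s) {k : ℝ}
    (hk : 0 ≤ k) (x : ℝ) {t : ℝ} (ht : 0 ≤ t) :
    |linearFlow k x g t| ≤ |x| + ∫ s in (0 : ℝ)..t, b s := by
  have h0 : 0 < Real.exp (-k * t) := Real.exp_pos _
  have h1 : Real.exp (-k * t) ≤ 1 := Real.exp_le_one_iff.2 (by nlinarith)
  have he : Real.exp (-k * t) * Real.exp (k * t) = 1 := by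
    rw [← Real.exp_add]; simp
  have h2 : |∫ s in (0 : ℝ)..t, Real.exp (k * s) * g s| ≤
      ∫ s in (0 : ℝ)..t, Real.exp (k * t) * b s := by
    refine (intervalIntegral.abs_integral_le_integral_abs ht).trans
      (intervalIntegral.integral_mono_on ht (hg.exp_mul k 0 t).abs ((hb 0 t).const_mul _) ?_)
    intro s hs
    rw [abs_mul, Real.abs_exp]
    exact mul_le_mul (Real.exp_le_exp.2 (mul_le_mul_of_nonneg_left hs.2 hk)) (hgb s)
      (abs_nonneg _) (Real.exp_pos _).le
  rw [intervalIntegral.integral_const_mul] at h2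
  calc |linearFlow k x g t|
      = Real.exp (-k * t) * |x + ∫ s in (0 : ℝ)..t, Real.exp (k * s) * g s| := by
        rw [linearFlow, abs_mul, Real.abs_exp]
    _ ≤ Real.exp (-k * t) * (|x| + Real.exp (k * t) * ∫ s in (0 : ℝ)..t, b s) := by
        gcongr
        exact (abs_add_le _ _).trans (by gcongr)
    _ = Real.exp (-k * t) * |x| + ∫ s in (0 : ℝ)..t, b s := by
        linear_combination (∫ s in (0 : ℝ)..t, b s) * he
    _ ≤ |x| + ∫ s in (0 : ℝ)..t, b s := by
        gcongr
        exact mul_le_of_le_one_left (abs_nonneg _) h1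

/-! ### The price as a functional of installation and noise paths -/

/-- The properties of the paths of admissible strategies. -/
structure IsInstallPath (C : ℝ) (i : ℝ≥0 → ℝ) : Prop where
  monotone : Monotone i
  nonneg : ∀ t, 0 ≤ i t
  rightContinuous : ∀ t, ContinuousWithinAt i (Ici t) t
  le : ∀ t, i t ≤ C

theorem continuousWithinAt_comp_toNNReal {f : ℝ≥0 → ℝ}
    (hf : ∀ t, ContinuousWithinAt f (Ici t) t) (t : ℝ) :
    ContinuousWithinAt (fun s : ℝ => f s.toNNReal) (Ici t) t :=
  (hf t.toNNReal).comp continuous_real_toNNReal.continuousWithinAt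
    fun _ hs => Real.toNNReal_le_toNNReal hs

/-- The forcing term of the equation solved by `X - σ W`. -/
noncomputable def priceForcing (p : Params) (y : ℝ) (i w : ℝ≥0 → ℝ) (s : ℝ) : ℝ :=
  p.κ * (p.μ - p.β * (y + i s.toNNReal) - p.σ * w s.toNNReal)

/-- The price path driven by the installation path `i` and the noise path `w`. -/
noncomputable def pricePath (p : Params) (x y : ℝ) (i w : ℝ≥0 → ℝ) (t : ℝ≥0) : ℝ :=
  p.σ * w t + linearFlow p.κ x (priceForcing p y i w) t

theorem IsInstallPath.monotone_comp {C : ℝ} {i : ℝ≥0 → ℝ} (hi : IsInstallPath C i) :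
    Monotone fun s : ℝ => i s.toNNReal :=
  fun _ _ h => hi.monotone (Real.toNNReal_le_toNNReal h)

theorem isForcing_priceForcing (p : Params) (y : ℝ) {C : ℝ} {i w : ℝ≥0 → ℝ}
    (hi : IsInstallPath C i) (hw : Continuous w) : IsForcing (priceForcing p y i w) := by
  have hwc : Continuous fun s : ℝ => w s.toNNReal := hw.comp continuous_real_toNNReal
  have hi' := hi.monotone_comp
  refine ⟨?_, fun a b => ?_, fun t => ?_⟩
  · have h1 := hi'.measurable
    have h2 := hwc.measurable
    exact ((measurable_const.sub ((measurable_const.add h1).const_mul _)).sub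
      (h2.const_mul _)).const_mul _
  · exact (((intervalIntegrable_const.sub ((intervalIntegrable_const.add
      hi'.intervalIntegrable).const_mul _)).sub
      ((hwc.const_mul p.σ).intervalIntegrable _ _)).const_mul _)
  · have h1 := continuousWithinAt_comp_toNNReal hi.rightContinuous t
    have h2 := hwc.continuousWithinAt (s := Ici t) (x := t)
    exact continuousWithinAt_const.mul ((continuousWithinAt_const.sub
      (continuousWithinAt_const.mul (continuousWithinAt_const.add h1))).sub
      (continuousWithinAt_const.mul h2))

theorem continuous_pricePath (p : Params) (x y : ℝ) {C : ℝ} {i w : ℝ≥0 → ℝ}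
    (hi : IsInstallPath C i) (hw : Continuous w) : Continuous (pricePath p x y i w) :=
  (hw.const_mul _).add
    (((isForcing_priceForcing p y hi hw).continuous_linearFlow _ _).comp NNReal.continuous_coe)

theorem pricePath_eq (p : Params) (x y : ℝ) {C : ℝ} {i w : ℝ≥0 → ℝ}
    (hi : IsInstallPath C i) (hw : Continuous w) (t : ℝ≥0) :
    pricePath p x y i w t = x + (∫ s in (0 : ℝ)..t,
      p.κ * ((p.μ - p.β * (y + i s.toNNReal)) - pricePath p x y i w s.toNNReal)) + p.σ * w t := by
  rw [pricePath, (isForcing_priceForcing p y hi hw).linearFlow_eq, add_comm]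
  congr 2
  refine intervalIntegral.integral_congr fun s hs => ?_
  rw [uIcc_of_le t.coe_nonneg] at hs
  simp only [pricePath, priceForcing, Real.coe_toNNReal s hs.1]
  ring

theorem eq_pricePath (p : Params) (x y : ℝ) {C : ℝ} {i w X : ℝ≥0 → ℝ}
    (hi : IsInstallPath C i) (hw : Continuous w) (hX : Continuous X)
    (heq : ∀ t : ℝ≥0, X t = x + (∫ s in (0 : ℝ)..t,
      p.κ * ((p.μ - p.β * (y + i s.toNNReal)) - X s.toNNReal)) + p.σ * w t) (t : ℝ≥0) :
    X t = pricePath p x y i w t := by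
  have hg := isForcing_priceForcing p y hi hw
  have := hg.eq_linearFlow (Y := fun s => X s.toNNReal - p.σ * w s.toNNReal)
    (by fun_prop) p.κ x (fun t ht => ?_) t t.coe_nonneg
  · simp only [Real.toNNReal_coe] at this
    rw [pricePath]
    linarith
  · rw [heq, Real.coe_toNNReal t ht, add_sub_cancel_right]
    congr 2 with s
    simp only [priceForcing]
    ring

theorem pricePath_mono (p : Params) (y : ℝ) (i w : ℝ≥0 → ℝ) (t : ℝ≥0) :
    Monotone fun x => pricePath p x y i w t := by
  intro x x' h
  simp only [pricePath]
  rw [linearFlow_add_initial p.κ x x']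
  nlinarith [mul_nonneg (Real.exp_pos (-p.κ * t)).le (sub_nonneg.2 h)]

/-- A bound for the part of the price that does not stem from the initial value. -/
noncomputable def priceBound (p : Params) (w : ℝ≥0 → ℝ) (t : ℝ) : ℝ :=
  p.σ * |w t.toNNReal| +
    ∫ s in (0 : ℝ)..t, p.κ * (|p.μ| + p.β * p.ybar + p.σ * |w s.toNNReal|)

theorem abs_pricePath_le {p : Params} (hκ : 0 < p.κ) (hσ : 0 < p.σ) (hβ : 0 < p.β) (x : ℝ) {y : ℝ}
    (hy : y ∈ Icc 0 p.ybar) {i w : ℝ≥0 → ℝ} (hi : IsInstallPath (p.ybar - y) i)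
    (hw : Continuous w) (t : ℝ≥0) :
    |pricePath p x y i w t| ≤ |x| + priceBound p w t := by
  have hg := isForcing_priceForcing p y hi hw
  have hwc : Continuous fun s : ℝ => w s.toNNReal := hw.comp continuous_real_toNNReal
  have hb : Continuous fun s : ℝ => p.κ * (|p.μ| + p.β * p.ybar + p.σ * |w s.toNNReal|) := by
    fun_prop
  have h := hg.abs_linearFlow_le (fun a c => hb.intervalIntegrable a c) (fun s => ?_) hκ.le x t.coe_nonneg
  · have h1 : |pricePath p x y i w t| ≤ |p.σ * w t| + |linearFlow p.κ x (priceForcing p y i w) t| :=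
      abs_add_le _ _
    rw [abs_mul, abs_of_pos hσ] at h1
    simp only [priceBound, Real.toNNReal_coe]
    linarith
  · rw [priceForcing, abs_mul, abs_of_pos hκ]
    gcongr
    have h1 := hi.nonneg s.toNNReal
    have h2 := hi.le s.toNNReal
    have h3 : |p.β * (y + i s.toNNReal)| ≤ p.β * p.ybar := by
      rw [abs_mul, abs_of_pos hβ, abs_of_nonneg (add_nonneg hy.1 h1)]
      gcongr
      linarith
    calc _ ≤ |p.μ - p.β * (y + i s.toNNReal)| + |p.σ * w s.toNNReal| := abs_sub _ _
      _ ≤ |p.μ| + |p.β * (y + i s.toNNReal)| + |p.σ * w s.toNNReal| := by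
        gcongr; exact abs_sub _ _
      _ ≤ _ := by
        rw [abs_mul p.σ, abs_of_pos hσ]
        gcongr

/-! ### Measurability and removal of null sets -/

/-- Time is rounded up to the grid of mesh `1 / (n + 1)`. Each rounded process is measurable because
the grid is countable, and right-continuity identifies the limit. -/
theorem measurable_uncurry_of_rightContinuous {Ω : Type*} [MeasurableSpace Ω] {Z : ℝ≥0 → Ω → ℝ}
    (hm : ∀ s, Measurable (Z s))
    (hrc : ∀ ω t, ContinuousWithinAt (fun s => Z s ω) (Ici t) t) :
    Measurable fun q : Ω × ℝ≥0 => Z q.2 q.1 := by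
  obtain ⟨τ, hτ⟩ : ∃ τ : ℕ → ℕ → ℝ≥0, ∀ n k, τ n k = ((k : ℝ≥0) + 1) / ((n : ℝ≥0) + 1) :=
    ⟨_, fun _ _ => rfl⟩
  have hlt : ∀ (n : ℕ) (s : ℝ≥0), s ≤ τ n ⌊((n : ℝ≥0) + 1) * s⌋₊ := fun n s => by
    rw [hτ, le_div_iff₀ (by positivity), mul_comm]
    exact (Nat.lt_floor_add_one _).le
  have hle : ∀ (n : ℕ) (s : ℝ≥0), τ n ⌊((n : ℝ≥0) + 1) * s⌋₊ ≤ s + 1 / ((n : ℝ≥0) + 1) :=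
    fun n s => by
      have h0 : ((n : ℝ≥0) + 1) ≠ 0 := by positivity
      rw [hτ, div_le_iff₀ (by positivity), add_mul s, div_mul_cancel₀ _ h0, mul_comm s]
      gcongr
      exact Nat.floor_le zero_le
  refine measurable_of_tendsto_metrizable
    (f := fun n (q : Ω × ℝ≥0) => Z (τ n ⌊((n : ℝ≥0) + 1) * q.2⌋₊) q.1) (fun n => ?_) ?_
  · have h1 : Measurable fun q : Ω × ℕ => Z (τ n q.2) q.1 :=
      measurable_from_prod_countable_left fun k => hm (τ n k)
    have h2 : Measurable fun q : Ω × ℝ≥0 => (q.1, ⌊((n : ℝ≥0) + 1) * q.2⌋₊) :=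
      measurable_fst.prodMk (Nat.measurable_floor.comp (measurable_snd.const_mul _))
    exact Measurable.comp (g := fun q : Ω × ℕ => Z (τ n q.2) q.1) h1 h2
  · refine tendsto_pi_nhds.2 fun q => ?_
    refine (hrc q.1 q.2).tendsto.comp (tendsto_nhdsWithin_iff.2 ⟨?_, .of_forall fun n => hlt n q.2⟩)
    refine tendsto_of_tendsto_of_tendsto_of_le_of_le tendsto_const_nhds ?_
      (fun n => hlt n q.2) (fun n => hle n q.2)
    simpa using (tendsto_one_div_add_atTop_nhds_zero_nat (𝕜 := ℝ≥0)).const_add q.2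

/-- Freezing time at `T` uses the process only up to `T`. With `𝓕 T` as the σ-algebra on `Ω` this
yields adaptedness of integrals up to `T`. -/
theorem measurable_uncurry_stopped {Ω : Type*} [MeasurableSpace Ω] {Z : ℝ≥0 → Ω → ℝ} {T : ℝ≥0}
    (hm : ∀ s ≤ T, Measurable (Z s))
    (hrc : ∀ ω t, ContinuousWithinAt (fun s => Z s ω) (Ici t) t) :
    Measurable fun q : Ω × ℝ => Z (min q.2.toNNReal T) q.1 := by
  have h := measurable_uncurry_of_rightContinuous (Z := fun s => Z (min s T))
    (fun s => hm _ (min_le_right _ _)) fun ω t =>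
      (hrc ω (min t T)).comp (f := fun s => min s T) (by fun_prop)
        fun s hs => min_le_min_right T hs
  exact h.comp (measurable_fst.prodMk (measurable_real_toNNReal.comp measurable_snd))

theorem measurable_intervalIntegral {Ω : Type*} [MeasurableSpace Ω] {f : Ω → ℝ → ℝ}
    (hf : Measurable (Function.uncurry f)) {t : ℝ} (ht : 0 ≤ t) :
    Measurable fun ω => ∫ s in (0 : ℝ)..t, f ω s := by
  simp only [intervalIntegral.integral_of_le ht]
  exact (hf.stronglyMeasurable.integral_prod_right).measurable

theorem measurable_pricePath {Ω : Type*} [MeasurableSpace Ω] (p : Params) (x y : ℝ)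
    {I W : ℝ≥0 → Ω → ℝ} {t : ℝ≥0} (hI : ∀ s ≤ t, Measurable (I s)) (hW : ∀ s ≤ t, Measurable (W s))
    (hIc : ∀ ω s, ContinuousWithinAt (fun s => I s ω) (Ici s) s)
    (hWc : ∀ ω, Continuous fun s => W s ω) :
    Measurable fun ω => pricePath p x y (fun s => I s ω) (fun s => W s ω) t := by
  have h1 := measurable_uncurry_stopped hI hIc
  have h2 := measurable_uncurry_stopped hW fun ω s => (hWc ω).continuousWithinAt
  have h3 : Measurable fun q : Ω × ℝ => Real.exp (p.κ * q.2) * (p.κ * (p.μ - p.β *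
      (y + I (min q.2.toNNReal t) q.1) - p.σ * W (min q.2.toNNReal t) q.1)) :=
    (Real.measurable_exp.comp (measurable_snd.const_mul _)).mul
      (((measurable_const.sub ((measurable_const.add h1).const_mul _)).sub
        (h2.const_mul _)).const_mul _)
  have h4 := measurable_intervalIntegral (f := fun ω s => Real.exp (p.κ * s) * (p.κ * (p.μ - p.β *
      (y + I (min s.toNNReal t) ω) - p.σ * W (min s.toNNReal t) ω))) h3 t.coe_nonneg
  have h5 : ∀ ω, pricePath p x y (fun s => I s ω) (fun s => W s ω) t = p.σ * W t ω +
      Real.exp (-p.κ * t) * (x + ∫ s in (0 : ℝ)..t, Real.exp (p.κ * s) * (p.κ * (p.μ - p.β *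
      (y + I (min s.toNNReal t) ω) - p.σ * W (min s.toNNReal t) ω))) := fun ω => by
    simp only [pricePath, linearFlow]
    congr 3
    refine intervalIntegral.integral_congr fun s hs => ?_
    rw [uIcc_of_le t.coe_nonneg] at hs
    -- The freezing is invisible inside an integral over `[0, t]`.
    have : min s.toNNReal t = s.toNNReal := min_eq_left (Real.toNNReal_le_iff_le_coe.2 hs.2)
    simp only [priceForcing, this]
  simp only [h5]
  exact ((hW t le_rfl).const_mul _).add ((h4.const_add x).const_mul _)

/-- The exceptional set is null, hence in `𝓕 0` and in every later `𝓕 t`; replacing the path by zero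
there keeps adaptedness. -/
theorem exists_modification {Ω : Type*} {mΩ : MeasurableSpace Ω} {P : Measure Ω}
    {𝓕 : Filtration ℝ≥0 mΩ} (hnull : ∀ s : Set Ω, P s = 0 → MeasurableSet[𝓕 0] s)
    {Z : ℝ≥0 → Ω → ℝ} (hZ : StronglyAdapted 𝓕 Z) {Q : (ℝ≥0 → ℝ) → Prop} (h0 : Q fun _ => 0)
    (hQ : ∀ᵐ ω ∂P, Q fun t => Z t ω) :
    ∃ Z' : ℝ≥0 → Ω → ℝ, StronglyAdapted 𝓕 Z' ∧ (∀ ω, Q fun t => Z' t ω) ∧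
      ∀ᵐ ω ∂P, (fun t => Z' t ω) = fun t => Z t ω := by
  classical
  have hs : MeasurableSet[𝓕 0] {ω | ¬ Q fun t => Z t ω} := hnull _ (ae_iff.1 hQ)
  refine ⟨fun t => {ω | ¬ Q fun t => Z t ω}ᶜ.indicator (Z t), fun t => ?_, fun ω => ?_, ?_⟩
  · exact (hZ t).indicator (𝓕.mono zero_le _ hs).compl
  · by_cases h : Q fun t => Z t ω
    · simp [indicator, h]
    · simp [indicator, h, h0]
  · filter_upwards [hQ] with ω h
    simp [indicator, h]

/-! ### The discounted installation cost -/

section Cost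

variable {C : ℝ} {f : ℝ≥0 → ℝ}

theorem IsInstallPath.monotone_extendByZero (hf : IsInstallPath C f) :
    Monotone (extendByZero f) := by
  intro a b hab
  simp only [extendByZero]
  split_ifs with h1 h2 h2
  · exact le_rfl
  · exact hf.nonneg _
  · linarith
  · exact hf.monotone (Real.toNNReal_le_toNNReal hab)

/-- The Stieltjes function is built from right limits, and the extended path is already
right-continuous. -/
theorem IsInstallPath.stieltjesFunction_apply (hf : IsInstallPath C f) (t : ℝ) :
    hf.monotone_extendByZero.stieltjesFunction t = extendByZero f t := by
  rw [Monotone.stieltjesFunction_eq]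
  refine rightLim_eq_of_tendsto ?_
  rcases lt_or_ge t 0 with ht | ht
  · refine Tendsto.congr' ?_ tendsto_const_nhds
    filter_upwards [mem_nhdsWithin_of_mem_nhds (Iio_mem_nhds ht)] with s hs
    simp only [extendByZero, ht, if_true, if_pos (show s < 0 from hs)]
  · have h := ((continuousWithinAt_comp_toNNReal hf.rightContinuous t).mono
      Ioi_subset_Ici_self).tendsto
    rw [extendByZero, if_neg ht.not_gt]
    refine h.congr' ?_
    filter_upwards [self_mem_nhdsWithin] with s hs
    rw [extendByZero, if_neg (ht.trans (le_of_lt hs)).not_gt]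

theorem IsInstallPath.leftLim_zero (hf : IsInstallPath C f) :
    Function.leftLim hf.monotone_extendByZero.stieltjesFunction 0 = 0 := by
  refine leftLim_eq_of_tendsto ?_
  refine Tendsto.congr' ?_ tendsto_const_nhds
  filter_upwards [self_mem_nhdsWithin] with s hs
  rw [hf.stieltjesFunction_apply, extendByZero, if_pos (show s < 0 from hs)]

theorem IsInstallPath.pathMeasure_eq (hf : IsInstallPath C f) :
    pathMeasure f = hf.monotone_extendByZero.stieltjesFunction.measure :=
  dif_pos hf.monotone_extendByZero

/-- The path vanishes at negative times, so the left limit at `0` is `0` and the initial jump is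
counted. -/
theorem IsInstallPath.pathMeasure_Icc (hf : IsInstallPath C f) {u : ℝ} (hu : 0 ≤ u) :
    pathMeasure f (Icc 0 u) = ENNReal.ofReal (f u.toNNReal) := by
  rw [hf.pathMeasure_eq, StieltjesFunction.measure_Icc, hf.leftLim_zero,
    hf.stieltjesFunction_apply, extendByZero, if_neg hu.not_gt, sub_zero]

theorem IsInstallPath.isFiniteMeasure_restrict (hf : IsInstallPath C f) :
    IsFiniteMeasure ((pathMeasure f).restrict (Ici 0)) := by
  have hb : BddAbove (range fun t => extendByZero f t) := ⟨C, by
    rintro _ ⟨t, rfl⟩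
    simp only [extendByZero]
    split_ifs
    · exact (hf.nonneg 0).trans (hf.le 0)
    · exact hf.le _⟩
  have hl := tendsto_atTop_ciSup hf.monotone_extendByZero hb
  refine ⟨?_⟩
  rw [Measure.restrict_apply_univ, hf.pathMeasure_eq, StieltjesFunction.measure_Ici _
    (hl.congr fun t => (hf.stieltjesFunction_apply t).symm)]
  exact ENNReal.ofReal_lt_top

theorem IsInstallPath.integrableOn_exp (hf : IsInstallPath C f) {ρ : ℝ} (hρ : 0 < ρ) :
    IntegrableOn (fun t => Real.exp (-ρ * t)) (Ici 0) (pathMeasure f) := by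
  have := hf.isFiniteMeasure_restrict
  refine Integrable.mono' (integrable_const (1 : ℝ))
    (by fun_prop) ((ae_restrict_iff' measurableSet_Ici).2 (.of_forall fun t ht => ?_))
  rw [Real.norm_eq_abs, Real.abs_exp, Real.exp_le_one_iff]
  nlinarith [show (0 : ℝ) ≤ t from ht]

theorem integrableOn_exp_neg_mul {ρ : ℝ} (hρ : 0 < ρ) (a : ℝ) :
    IntegrableOn (fun t : ℝ => Real.exp (-ρ * t)) (Ioi a) :=
  exp_neg_integrableOn_Ioi a hρ

theorem integral_exp_neg_mul_Ioi {ρ : ℝ} (hρ : 0 < ρ) (a : ℝ) :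
    ∫ t in Ioi a, Real.exp (-ρ * t) = Real.exp (-ρ * a) / ρ := by
  rw [integral_exp_mul_Ioi (neg_lt_zero.2 hρ), neg_div_neg_eq]

/-- Integration by parts for the discounted installation cost. -/
theorem IsInstallPath.discountedInstallation_eq (hf : IsInstallPath C f) {ρ : ℝ} (hρ : 0 < ρ) :
    discountedInstallation ρ f = ∫ u in Ioi (0 : ℝ), ρ * Real.exp (-ρ * u) * f u.toNNReal := by
  have := hf.isFiniteMeasure_restrict
  -- Write `exp (-ρ t)` as the integral of `ρ exp (-ρ u)` over `u ≥ t` and exchange the integrals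
  -- over the region `t ≤ u`.
  let F : ℝ → ℝ → ℝ := fun t u => {q : ℝ × ℝ | q.1 ≤ q.2}.indicator
    (fun q => ρ * Real.exp (-ρ * q.2)) (t, u)
  have hF : Integrable (Function.uncurry F)
      (((pathMeasure f).restrict (Ici 0)).prod (volume.restrict (Ioi 0))) := by
    have h1 : Integrable (fun q : ℝ × ℝ => ρ * Real.exp (-ρ * q.2))
        (((pathMeasure f).restrict (Ici 0)).prod (volume.restrict (Ioi 0))) :=
      Integrable.comp_snd ((integrableOn_exp_neg_mul hρ 0).const_mul ρ) _
    exact h1.indicator (measurableSet_le measurable_fst measurable_snd)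
  have h1 : discountedInstallation ρ f = ∫ t in Ici (0 : ℝ), (∫ u in Ioi (0 : ℝ), F t u)
      ∂(pathMeasure f) := by
    refine setIntegral_congr_fun measurableSet_Ici fun t (ht : 0 ≤ t) => ?_
    have h2 : ∀ u, F t u = (Ici t).indicator (fun u => ρ * Real.exp (-ρ * u)) u := fun u => by
      simp only [F, indicator, mem_ofPred_eq, mem_Ici]
    simp only [h2]
    rw [setIntegral_indicator measurableSet_Ici]
    have h3 : (Ioi 0 ∩ Ici t : Set ℝ) =ᵐ[volume] Ioi t := by
      have h4 : (Ioi 0 ∩ Ioi t : Set ℝ) = Ioi t := by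
        rw [Ioi_inter_Ioi, max_eq_right ht]
      exact ((ae_eq_refl _).inter Ioi_ae_eq_Ici.symm).trans h4.eventuallyEq
    rw [setIntegral_congr_set h3, integral_const_mul, integral_exp_neg_mul_Ioi hρ]
    field_simp
  rw [h1, integral_integral_swap hF]
  refine setIntegral_congr_fun measurableSet_Ioi fun u (hu : 0 < u) => ?_
  have h2 : ∀ t, F t u = (Iic u).indicator (fun _ => ρ * Real.exp (-ρ * u)) t := fun t => by
    simp only [F, indicator, mem_ofPred_eq, mem_Iic]
  simp only [h2]
  rw [setIntegral_indicator measurableSet_Iic, Ici_inter_Iic, setIntegral_const, Measure.real,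
    hf.pathMeasure_Icc hu.le, ENNReal.toReal_ofReal (hf.nonneg _), smul_eq_mul]
  ring

theorem IsInstallPath.discountedInstallation_nonneg (hf : IsInstallPath C f) {ρ : ℝ}
    (hρ : 0 < ρ) : 0 ≤ discountedInstallation ρ f := by
  rw [hf.discountedInstallation_eq hρ]
  exact integral_nonneg fun u => mul_nonneg (mul_nonneg hρ.le (Real.exp_pos _).le) (hf.nonneg _)

/-- After integration by parts the cost is an average of the path against the probability density `ρ
exp (-ρ u)`. -/
theorem IsInstallPath.discountedInstallation_le (hf : IsInstallPath C f) {ρ : ℝ} (hρ : 0 < ρ) :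
    discountedInstallation ρ f ≤ C := by
  have h : ∫ u in Ioi (0 : ℝ), Real.exp (-ρ * u) * (ρ * C) = C := by
    rw [integral_mul_const, integral_exp_neg_mul_Ioi hρ]
    simp
    field_simp
  rw [hf.discountedInstallation_eq hρ, ← h]
  refine integral_mono_of_nonneg (.of_forall fun u => ?_)
    ((integrableOn_exp_neg_mul hρ 0).mul_const _) (.of_forall fun u => ?_)
  · exact mul_nonneg (mul_nonneg hρ.le (Real.exp_pos _).le) (hf.nonneg _)
  · have := mul_le_mul_of_nonneg_left (hf.le u.toNNReal)
      (mul_nonneg hρ.le (Real.exp_pos (-ρ * u)).le)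
    simp only
    linarith

end Cost

/-! ### Regular versions of noise and strategies -/

/-- The properties of Brownian motion used below, without exceptional null sets. -/
structure IsRegularNoise {Ω : Type*} {mΩ : MeasurableSpace Ω} (P : Measure Ω)
    (W : ℝ≥0 → Ω → ℝ) : Prop where
  measurable : ∀ t, Measurable (W t)
  continuous : ∀ ω, Continuous fun t => W t ω
  integrable : ∀ t, Integrable (W t) P
  integral_eq_zero : ∀ t, ∫ ω, W t ω ∂P = 0
  integral_abs_le : ∀ t : ℝ≥0, ∫ ω, |W t ω| ∂P ≤ 1 + t

/-- From `|w| ≤ 1 + w ^ 2` and variance `t`. -/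
theorem integral_abs_brownian_le {Ω : Type*} {mΩ : MeasurableSpace Ω} {P : Measure Ω}
    [IsProbabilityMeasure P] {W : ℝ≥0 → Ω → ℝ} (hW : IsPreBrownianReal W P) (t : ℝ≥0) :
    ∫ ω, |W t ω| ∂P ≤ 1 + t := by
  have hL : MemLp (W t) 2 P := (hW.isGaussianProcess.hasGaussianLaw_eval t).memLp_two
  have hv : Var[W t; P] = t := by
    rw [(hW.hasLaw_eval t).variance_eq, variance_id_gaussianReal]
  rw [variance_eq_sub hL, hW.integral_eval t] at hv
  have hv' : ∫ ω, W t ω ^ 2 ∂P = t := by simpa using hv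
  calc ∫ ω, |W t ω| ∂P ≤ ∫ ω, (1 + W t ω ^ 2) ∂P :=
        integral_mono (hW.integrable_eval t).abs ((integrable_const _).add hL.integrable_sq)
          fun ω => by nlinarith [sq_abs (W t ω), sq_nonneg (|W t ω| - 1), abs_nonneg (W t ω)]
    _ = 1 + t := by
        rw [integral_add (integrable_const _) hL.integrable_sq, hv']
        simp

theorem IsFBrownian.exists_regular {Ω : Type*} {mΩ : MeasurableSpace Ω} {P : Measure Ω}
    [IsProbabilityMeasure P] {𝓕 : Filtration ℝ≥0 mΩ} (h𝓕 : UsualConditions P 𝓕)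
    {W : ℝ≥0 → Ω → ℝ} (hW : IsFBrownian P 𝓕 W) :
    ∃ W', StronglyAdapted 𝓕 W' ∧ IsRegularNoise P W' ∧
      ∀ᵐ ω ∂P, (fun t => W' t ω) = fun t => W t ω := by
  obtain ⟨W', h1, h2, h3⟩ := exists_modification (Q := Continuous) h𝓕.null_mem hW.adapted
    continuous_const hW.brownian.cont
  have h4 : ∀ t, W' t =ᵐ[P] W t := fun t => h3.mono fun ω h => congrFun h t
  have hB := hW.brownian.toIsPreBrownianReal.congr fun t => (h4 t).symm
  exact ⟨W', h1, ⟨fun t => ((h1 t).mono (𝓕.le t)).measurable, h2, hB.integrable_eval,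
    hB.integral_eval, integral_abs_brownian_le hB⟩, h3⟩

theorem isInstallPath_zero {C : ℝ} (hC : 0 ≤ C) : IsInstallPath C fun _ => 0 :=
  ⟨monotone_const, fun _ => le_rfl, fun _ => continuousWithinAt_const, fun _ => hC⟩

theorem Admissible.ae_isInstallPath {Ω : Type*} {mΩ : MeasurableSpace Ω} {P : Measure Ω}
    {𝓕 : Filtration ℝ≥0 mΩ} {p : Params} {y : ℝ} {I : ℝ≥0 → Ω → ℝ} (hI : Admissible P 𝓕 p y I) :
    ∀ᵐ ω ∂P, IsInstallPath (p.ybar - y) fun t => I t ω := by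
  filter_upwards [hI.monotone, hI.cadlag, hI.le_capacity] with ω h1 h2 h3
  exact ⟨h1, fun t => hI.nonneg t ω, fun t => (h2 t).1, h3⟩

theorem admissible_zero {Ω : Type*} {mΩ : MeasurableSpace Ω} {P : Measure Ω}
    {𝓕 : Filtration ℝ≥0 mΩ} {p : Params} {y : ℝ} (hy : y ≤ p.ybar) : Admissible P 𝓕 p y 0 where
  adapted := stronglyAdapted_zero ℝ 𝓕
  nonneg _ _ := le_rfl
  monotone := .of_forall fun _ => monotone_const
  cadlag := .of_forall fun _ _ => ⟨continuousWithinAt_const, 0, tendsto_const_nhds⟩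
  le_capacity := .of_forall fun _ _ => sub_nonneg.2 hy

/-! ### Integrability on the product of `Ω` and time, and the mean price -/

/-- Integrating over `Ω` first reduces product integrability to a bound on the mean at each time,
with no pathwise growth estimate on `W`. -/
theorem integrable_prod_of_integral_norm_le {Ω : Type*} {mΩ : MeasurableSpace Ω} {P : Measure Ω}
    [SFinite P] {ν : Measure ℝ} [SFinite ν] {Z : Ω → ℝ → ℝ} {a : ℝ → ℝ}
    (hZ : AEStronglyMeasurable (Function.uncurry Z) (P.prod ν)) (ha : Integrable a ν)
    (h : ∀ᵐ t ∂ν, Integrable (fun ω => Z ω t) P ∧ ∫ ω, ‖Z ω t‖ ∂P ≤ a t) :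
    Integrable (Function.uncurry Z) (P.prod ν) := by
  refine (integrable_prod_iff' hZ).2 ⟨h.mono fun t ht => ht.1, ?_⟩
  refine ha.mono' hZ.norm.prod_swap.integral_prod_right' (h.mono fun t ht => ?_)
  rw [Real.norm_of_nonneg (integral_nonneg fun _ => norm_nonneg _)]
  exact ht.2

theorem integrableOn_exp_mul_pow {ρ : ℝ} (hρ : 0 < ρ) (n : ℕ) :
    IntegrableOn (fun t : ℝ => Real.exp (-ρ * t) * t ^ n) (Ioi 0) := by
  refine (integrableOn_rpow_mul_exp_neg_mul_rpow (p := 1) (s := n) (b := ρ)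
    (by have : (0 : ℝ) ≤ n := n.cast_nonneg
        linarith) one_pos hρ).congr_fun (fun t _ => ?_) measurableSet_Ioi
  simp only [Real.rpow_one, Real.rpow_natCast, mul_comm]

section

variable {Ω : Type*} {mΩ : MeasurableSpace Ω} {P : Measure Ω}
  {W I : ℝ≥0 → Ω → ℝ} {p : Params} {x y : ℝ}

theorem IsRegularNoise.measurable_uncurry (hW : IsRegularNoise P W) :
    Measurable fun q : Ω × ℝ => W q.2.toNNReal q.1 :=
  (measurable_uncurry_of_rightContinuous hW.measurable
    fun ω _ => (hW.continuous ω).continuousWithinAt).comp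
    (measurable_fst.prodMk (measurable_real_toNNReal.comp measurable_snd))

/-- The discounted revenue rate as a function of the installation and noise paths. -/
noncomputable def pathRevenueRate (p : Params) (x y : ℝ) (i w : ℝ≥0 → ℝ) (t : ℝ) : ℝ :=
  Real.exp (-p.ρ * t) * pricePath p x y i w t.toNNReal * (y + i t.toNNReal)

/-- Uses `0 ≤ y + i ≤ ybar`. The bound is free of `i` and `y`, so it dominates all strategies at
once. -/
theorem abs_pathRevenueRate_le (hκ : 0 < p.κ) (hσ : 0 < p.σ) (hβ : 0 < p.β)
    (hy : y ∈ Icc 0 p.ybar) {i w : ℝ≥0 → ℝ} (hi : IsInstallPath (p.ybar - y) i)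
    (hw : Continuous w) {t : ℝ} (ht : 0 ≤ t) :
    |pathRevenueRate p x y i w t| ≤
      p.ybar * (|x| * Real.exp (-p.ρ * t) + Real.exp (-p.ρ * t) * priceBound p w t) := by
  have h1 := abs_pricePath_le hκ hσ hβ x hy hi hw t.toNNReal
  rw [Real.coe_toNNReal t ht] at h1
  have h2 := hi.nonneg t.toNNReal
  have h3 := hi.le t.toNNReal
  have h4 := (abs_nonneg _).trans h1
  rw [pathRevenueRate, abs_mul, abs_mul, Real.abs_exp, abs_of_nonneg (add_nonneg hy.1 h2)]
  calc _ ≤ Real.exp (-p.ρ * t) * (|x| + priceBound p w t) * p.ybar := by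
        gcongr
        · exact add_nonneg hy.1 h2
        · linarith
    _ = _ := by ring

theorem measurable_pathRevenueRate (hW : IsRegularNoise P W) {C : ℝ}
    (hIm : ∀ t, Measurable (I t)) (hI : ∀ ω, IsInstallPath C fun t => I t ω) :
    Measurable fun q : Ω × ℝ =>
      pathRevenueRate p x y (fun t => I t q.1) (fun t => W t q.1) q.2 := by
  have h1 : Measurable fun q : Ω × ℝ≥0 =>
      pricePath p x y (fun t => I t q.1) (fun t => W t q.1) q.2 :=
    measurable_uncurry_of_rightContinuous
      (Z := fun t ω => pricePath p x y (fun t => I t ω) (fun t => W t ω) t)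
      (fun t => measurable_pricePath p x y (fun s _ => hIm s) (fun s _ => hW.measurable s)
        (fun ω => (hI ω).rightContinuous) hW.continuous)
      fun ω t => (continuous_pricePath p x y (hI ω) (hW.continuous ω)).continuousWithinAt
  have h2 := measurable_uncurry_of_rightContinuous hIm fun ω => (hI ω).rightContinuous
  have h3 : Measurable fun q : Ω × ℝ => (q.1, q.2.toNNReal) :=
    measurable_fst.prodMk (measurable_real_toNNReal.comp measurable_snd)
  exact ((Real.measurable_exp.comp (measurable_snd.const_mul _)).mul (h1.comp h3)).mul
    ((h2.comp h3).const_add y)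

theorem IsRegularNoise.measurable_primitive (hW : IsRegularNoise P W) (a b c : ℝ) (t : ℝ≥0) :
    Measurable fun ω => ∫ s in (0 : ℝ)..t, c * (a + b * |W s.toNNReal ω|) := by
  have := hW.measurable_uncurry
  refine measurable_intervalIntegral (f := fun ω s => c * (a + b * |W s.toNNReal ω|))
    ?_ t.coe_nonneg
  exact ((this.norm.const_mul b).const_add a).const_mul c

variable [IsProbabilityMeasure P]

theorem IsRegularNoise.integrable_add_mul_abs (hW : IsRegularNoise P W) (a b : ℝ) (t : ℝ≥0) :
    Integrable (fun ω => a + b * |W t ω|) P :=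
  (integrable_const _).add ((hW.integrable t).abs.const_mul _)

theorem IsRegularNoise.integral_add_mul_abs_le (hW : IsRegularNoise P W) (a : ℝ) {b : ℝ}
    (hb : 0 ≤ b) (t : ℝ≥0) : ∫ ω, (a + b * |W t ω|) ∂P ≤ a + b * (1 + t) := by
  rw [integral_add (integrable_const _) ((hW.integrable t).abs.const_mul _), integral_const_mul]
  have := mul_le_mul_of_nonneg_left (hW.integral_abs_le t) hb
  simpa using this

theorem IsRegularNoise.integrable_primitive (hW : IsRegularNoise P W) {a b c : ℝ} (ha : 0 ≤ a)
    (hb : 0 ≤ b) (hc : 0 ≤ c) (t : ℝ≥0) :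
    Integrable (fun ω => ∫ s in (0 : ℝ)..t, c * (a + b * |W s.toNNReal ω|)) P ∧
    ∫ ω, (∫ s in (0 : ℝ)..t, c * (a + b * |W s.toNNReal ω|)) ∂P ≤ t * (c * (a + b * (1 + t))) := by
  have hm : Measurable (Function.uncurry fun ω (s : ℝ) => c * (a + b * |W s.toNNReal ω|)) :=
    ((hW.measurable_uncurry.norm.const_mul b).const_add a).const_mul c
  have hle : ∀ s : ℝ≥0, ∫ ω, c * (a + b * |W s ω|) ∂P ≤ c * (a + b * (1 + s)) := fun s => by
    rw [integral_const_mul]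
    exact mul_le_mul_of_nonneg_left (hW.integral_add_mul_abs_le a hb s) hc
  have hi : Integrable (Function.uncurry fun ω (s : ℝ) => c * (a + b * |W s.toNNReal ω|))
      (P.prod (volume.restrict (Ioc 0 (t : ℝ)))) := by
    refine integrable_prod_of_integral_norm_le (a := fun s => c * (a + b * (1 + s.toNNReal)))
      hm.aestronglyMeasurable ?_ (.of_forall fun s => ⟨?_, ?_⟩)
    · exact Continuous.integrableOn_Ioc (by fun_prop)
    · exact (hW.integrable_add_mul_abs a b _).const_mul c
    · simpa only [Real.norm_of_nonneg (show 0 ≤ c * (a + b * |W s.toNNReal _|) by positivity)]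
        using hle s.toNNReal
  simp only [intervalIntegral.integral_of_le t.coe_nonneg]
  refine ⟨hi.integral_prod_left, ?_⟩
  rw [integral_integral_swap hi]
  calc ∫ s in Ioc 0 (t : ℝ), ∫ ω, c * (a + b * |W s.toNNReal ω|) ∂P
      ≤ ∫ s in Ioc 0 (t : ℝ), c * (a + b * (1 + t)) := by
        refine setIntegral_mono_on hi.integral_prod_right (integrable_const _) measurableSet_Ioc fun s hs => ?_
        refine (hle s.toNNReal).trans ?_
        rw [Real.coe_toNNReal s hs.1.le]
        gcongr
        exact hs.2
    _ = t * (c * (a + b * (1 + t))) := by simp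

theorem IsRegularNoise.integrable_priceBound (hW : IsRegularNoise P W) (hκ : 0 < p.κ)
    (hσ : 0 < p.σ) (hβ : 0 < p.β) (hρ : 0 < p.ρ) (hybar : 0 ≤ p.ybar) :
    Integrable (fun q : Ω × ℝ => Real.exp (-p.ρ * q.2) * priceBound p (fun t => W t q.1) q.2)
      (P.prod (volume.restrict (Ioi 0))) := by
  set M : ℝ := |p.μ| + p.β * p.ybar with hM
  have hM0 : 0 ≤ M := by positivity
  -- The summands bound the means of the two terms of `priceBound`: the first by `E|W_t| ≤ 1 + t`,
  -- the second by `integrable_primitive`.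
  let a : ℝ → ℝ := fun t => Real.exp (-p.ρ * t) *
    (p.σ * (1 + t) + t * (p.κ * (M + p.σ * (1 + t))))
  have ha : IntegrableOn a (Ioi 0) := by
    refine ((((integrableOn_exp_mul_pow hρ 0).const_mul p.σ).add
      ((integrableOn_exp_mul_pow hρ 1).const_mul (p.σ + p.κ * M + p.κ * p.σ))).add
      ((integrableOn_exp_mul_pow hρ 2).const_mul (p.κ * p.σ))).congr (.of_forall fun t => ?_)
    simp only [a, Pi.add_apply]
    ring
  have hc : ∀ ω, Continuous fun s : ℝ => p.κ * (M + p.σ * |W s.toNNReal ω|) := fun ω => by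
    have := (hW.continuous ω).comp continuous_real_toNNReal
    exact ((this.abs.const_mul _).const_add _).const_mul _
  have hm : Measurable fun q : Ω × ℝ≥0 => priceBound p (fun t => W t q.1) q.2 := by
    refine measurable_uncurry_of_rightContinuous
      (Z := fun t ω => priceBound p (fun t => W t ω) t) (fun t => ?_) fun ω t => ?_
    · simp only [priceBound, Real.toNNReal_coe]
      exact ((hW.measurable t).norm.const_mul _).add (hW.measurable_primitive _ _ _ t)
    · refine Continuous.continuousWithinAt ?_
      simp only [priceBound, Real.toNNReal_coe]
      have h1 := (intervalIntegral.continuous_primitive (μ := volume)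
        (fun a b => (hc ω).intervalIntegrable a b) 0).comp NNReal.continuous_coe
      exact ((hW.continuous ω).abs.const_mul _).add h1
  have hm' : Measurable fun q : Ω × ℝ => Real.exp (-p.ρ * q.2) *
      priceBound p (fun t => W t q.1) q.2.toNNReal :=
    (Real.measurable_exp.comp (measurable_snd.const_mul _)).mul
      (hm.comp (measurable_fst.prodMk (measurable_real_toNNReal.comp measurable_snd)))
  refine integrable_prod_of_integral_norm_le (a := a)
    (Z := fun ω t => Real.exp (-p.ρ * t) * priceBound p (fun t => W t ω) t) ?_ ha ?_
  · refine hm'.aestronglyMeasurable.congr ?_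
    have h0 : ∀ᵐ q : Ω × ℝ ∂P.prod (volume.restrict (Ioi 0)), q.2 ∈ Ioi (0 : ℝ) :=
      Measure.quasiMeasurePreserving_snd.ae (ae_restrict_mem measurableSet_Ioi)
    filter_upwards [h0] with q hq
    simp only [Function.uncurry, Real.coe_toNNReal q.2 (le_of_lt hq)]
  · refine (ae_restrict_iff' measurableSet_Ioi).2 (.of_forall fun t (ht : 0 < t) => ?_)
    lift t to ℝ≥0 using ht.le
    obtain ⟨h1, h2⟩ := hW.integrable_primitive hM0 hσ.le hκ.le t
    have h3 := (hW.integrable t).abs.const_mul p.σ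
    have h4 : ∀ ω, 0 ≤ priceBound p (fun t => W t ω) t := fun ω =>
      add_nonneg (by positivity)
        (intervalIntegral.integral_nonneg t.coe_nonneg fun s _ => by positivity)
    simp only [Real.norm_of_nonneg (mul_nonneg (Real.exp_pos _).le (h4 _))]
    simp only [priceBound, Real.toNNReal_coe]
    refine ⟨(h3.add h1).const_mul _, ?_⟩
    rw [integral_const_mul, integral_add h3 h1, integral_const_mul]
    simp only [a]
    gcongr
    exact hW.integral_abs_le t

theorem IsRegularNoise.integrable_dominating (hW : IsRegularNoise P W) (hκ : 0 < p.κ)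
    (hσ : 0 < p.σ) (hβ : 0 < p.β) (hρ : 0 < p.ρ) (hybar : 0 ≤ p.ybar) (x : ℝ) :
    Integrable (fun q : Ω × ℝ => p.ybar * (|x| * Real.exp (-p.ρ * q.2) +
      Real.exp (-p.ρ * q.2) * priceBound p (fun t => W t q.1) q.2))
      (P.prod (volume.restrict (Ioi 0))) :=
  ((Integrable.comp_snd ((integrableOn_exp_neg_mul hρ 0).const_mul |x|) P).add
    (hW.integrable_priceBound hκ hσ hβ hρ hybar)).const_mul _

theorem integrable_pathRevenueRate (hW : IsRegularNoise P W) (hκ : 0 < p.κ)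
    (hσ : 0 < p.σ) (hβ : 0 < p.β) (hρ : 0 < p.ρ) (hy : y ∈ Icc 0 p.ybar)
    (hIm : ∀ t, Measurable (I t)) (hI : ∀ ω, IsInstallPath (p.ybar - y) fun t => I t ω) :
    Integrable (fun q : Ω × ℝ => pathRevenueRate p x y (fun t => I t q.1) (fun t => W t q.1) q.2)
      (P.prod (volume.restrict (Ioi 0))) := by
  refine (hW.integrable_dominating hκ hσ hβ hρ (hy.1.trans hy.2) x).mono'
    (measurable_pathRevenueRate hW hIm hI).aestronglyMeasurable ?_
  have h0 : ∀ᵐ q : Ω × ℝ ∂P.prod (volume.restrict (Ioi 0)), q.2 ∈ Ioi (0 : ℝ) :=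
    Measure.quasiMeasurePreserving_snd.ae (ae_restrict_mem measurableSet_Ioi)
  filter_upwards [h0] with q hq
  exact abs_pathRevenueRate_le hκ hσ hβ hy (hI q.1) (hW.continuous q.1) (le_of_lt hq)

/-- The centred noise drops out of the mean after Fubini, leaving the flow with constant forcing `κ
(μ - β y)`. -/
theorem integral_pricePath_zero (hW : IsRegularNoise P W) (hκ : 0 < p.κ) (hσ : 0 < p.σ)
    (t : ℝ≥0) :
    ∫ ω, pricePath p x y (fun _ => 0) (fun t => W t ω) t ∂P =
      Real.exp (-p.κ * t) * x + (p.μ - p.β * y) * (1 - Real.exp (-p.κ * t)) := by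
  let f : Ω → ℝ → ℝ := fun ω s => Real.exp (p.κ * s) * priceForcing p y (fun _ => 0)
    (fun t => W t ω) s
  have hm : Measurable (Function.uncurry f) := by
    have h := hW.measurable_uncurry
    exact (Real.measurable_exp.comp (measurable_snd.const_mul _)).mul
      ((measurable_const.sub (h.const_mul p.σ)).const_mul p.κ)
  have hfi : ∀ s, Integrable (f · s) P := fun s =>
    (((integrable_const _).sub ((hW.integrable _).const_mul p.σ)).const_mul _).const_mul _
  have hfe : ∀ s, ∫ ω, f ω s ∂P = (p.μ - p.β * y) * (Real.exp (p.κ * s) * p.κ) := fun s => by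
    simp only [f, priceForcing]
    rw [integral_const_mul, integral_const_mul, integral_sub (integrable_const _)
      ((hW.integrable _).const_mul p.σ), integral_const_mul, hW.integral_eq_zero]
    simp
    ring
  have hi : Integrable (Function.uncurry f) (P.prod (volume.restrict (Ioc 0 (t : ℝ)))) := by
    refine integrable_prod_of_integral_norm_le (a := fun s => Real.exp (p.κ * s) *
      (p.κ * (|p.μ - p.β * y| + p.σ * (1 + s.toNNReal)))) hm.aestronglyMeasurable
      (Continuous.integrableOn_Ioc (by fun_prop)) (.of_forall fun s => ⟨hfi s, ?_⟩)
    calc ∫ ω, ‖f ω s‖ ∂P ≤ ∫ ω, Real.exp (p.κ * s) *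
          (p.κ * (|p.μ - p.β * y| + p.σ * |W s.toNNReal ω|)) ∂P := by
          refine integral_mono (hfi s).norm
            (((hW.integrable_add_mul_abs _ _ _).const_mul _).const_mul _) fun ω => ?_
          simp only [f, priceForcing, Real.norm_eq_abs, abs_mul, Real.abs_exp, abs_of_pos hκ,
            add_zero]
          gcongr
          refine (abs_sub _ _).trans ?_
          rw [abs_mul, abs_of_pos hσ]
      _ ≤ _ := by
          rw [integral_const_mul, integral_const_mul]
          gcongr
          exact hW.integral_add_mul_abs_le _ hσ.le _
  have hd : ∫ s in (0 : ℝ)..t, Real.exp (p.κ * s) * p.κ = Real.exp (p.κ * t) - 1 := by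
    rw [intervalIntegral.integral_eq_sub_of_hasDerivAt (f := fun s => Real.exp (p.κ * s))]
    · simp
    · intro s _
      simpa using ((hasDerivAt_id s).const_mul p.κ).exp
    · exact Continuous.intervalIntegrable (by fun_prop) _ _
  have he : Real.exp (-p.κ * t) * Real.exp (p.κ * t) = 1 := by
    rw [← Real.exp_add]; simp
  have hI : ∫ ω, (∫ s in Ioc 0 (t : ℝ), f ω s) ∂P =
      (p.μ - p.β * y) * (Real.exp (p.κ * t) - 1) := by
    rw [integral_integral_swap hi, ← hd, intervalIntegral.integral_of_le t.coe_nonneg,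
      ← integral_const_mul]
    exact integral_congr_ae (.of_forall hfe)
  have hL : Integrable (fun ω => ∫ s in Ioc 0 (t : ℝ), f ω s) P := hi.integral_prod_left
  have hP : ∀ ω, pricePath p x y (fun _ => 0) (fun t => W t ω) t = p.σ * W t ω +
      Real.exp (-p.κ * t) * (x + ∫ s in Ioc 0 (t : ℝ), f ω s) := fun ω => by
    simp only [pricePath, linearFlow, intervalIntegral.integral_of_le t.coe_nonneg, f]
  have hS : Integrable (fun ω => x + ∫ s in Ioc 0 (t : ℝ), f ω s) P := (integrable_const _).add hL
  simp only [hP]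
  rw [integral_add ((hW.integrable t).const_mul _)
    (hS.const_mul _), integral_const_mul, integral_const_mul,
    hW.integral_eq_zero, integral_add (integrable_const _) hL, hI]
  simp only [integral_const, probReal_univ, one_smul]
  linear_combination (p.μ - p.β * y) * he

end

/-! ### From paths back to processes -/

/-- The net profit as a function of the installation and noise paths. -/
noncomputable def pathNetProfit (p : Params) (x y : ℝ) (i w : ℝ≥0 → ℝ) : ℝ :=
  (∫ t in Ioi (0 : ℝ), pathRevenueRate p x y i w t) - p.c * discountedInstallation p.ρ i

section

variable {Ω : Type*} {mΩ : MeasurableSpace Ω} {P : Measure Ω} {𝓕 : Filtration ℝ≥0 mΩ}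
  {W I : ℝ≥0 → Ω → ℝ} {p : Params} {x y : ℝ}

theorem IsPrice.ae_eq_pricePath {X : ℝ≥0 → Ω → ℝ} (hX : IsPrice P 𝓕 W p x y I X)
    (hI : Admissible P 𝓕 p y I) (hW : ∀ᵐ ω ∂P, Continuous fun t => W t ω) :
    ∀ᵐ ω ∂P, ∀ t, X t ω = pricePath p x y (fun t => I t ω) (fun t => W t ω) t := by
  filter_upwards [hX.continuous, hX.equation, hI.ae_isInstallPath, hW] with ω h1 h2 h3 h4 t
  exact eq_pricePath p x y h3 h4 h1 h2 t

/-- Built from the regular versions, the candidate is continuous everywhere; the equation needs only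
their almost sure agreement with `I` and `W`. -/
theorem isPrice_pricePath {I' W' : ℝ≥0 → Ω → ℝ} {C : ℝ} (hIa : StronglyAdapted 𝓕 I')
    (hI : ∀ ω, IsInstallPath C fun t => I' t ω) (hWa : StronglyAdapted 𝓕 W')
    (hW : ∀ ω, Continuous fun t => W' t ω) (hII : ∀ᵐ ω ∂P, (fun t => I' t ω) = fun t => I t ω)
    (hWW : ∀ᵐ ω ∂P, (fun t => W' t ω) = fun t => W t ω) :
    IsPrice P 𝓕 W p x y I
      fun t ω => pricePath p x y (fun t => I' t ω) (fun t => W' t ω) t where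
  adapted t := by
    refine Measurable.stronglyMeasurable ?_
    -- The measurability lemma is used with `𝓕 t` as the σ-algebra on `Ω`.
    exact @measurable_pricePath Ω (𝓕 t) p x y I' W' t
      (fun s hs => ((hIa s).mono (𝓕.mono hs)).measurable)
      (fun s hs => ((hWa s).mono (𝓕.mono hs)).measurable)
      (fun ω => (hI ω).rightContinuous) hW
  continuous := .of_forall fun ω => continuous_pricePath p x y (hI ω) (hW ω)
  equation := by
    filter_upwards [hII, hWW] with ω h1 h2 t
    rw [← congrFun h2 t, pricePath_eq p x y (hI ω) (hW ω) t]
    have h3 : ∀ s, I s ω = I' s ω := fun s => (congrFun h1 s).symm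
    simp only [h3]

/-- An admissible strategy has a modification all of whose paths are installation paths. -/
theorem Admissible.exists_regular (h𝓕 : UsualConditions P 𝓕) (hy : y ≤ p.ybar)
    (hI : Admissible P 𝓕 p y I) :
    ∃ I', StronglyAdapted 𝓕 I' ∧ (∀ ω, IsInstallPath (p.ybar - y) fun t => I' t ω) ∧
      ∀ᵐ ω ∂P, (fun t => I' t ω) = fun t => I t ω :=
  exists_modification h𝓕.null_mem hI.adapted (isInstallPath_zero (sub_nonneg.2 hy))
    hI.ae_isInstallPath

variable [IsProbabilityMeasure P]

theorem isPrice_price (h𝓕 : UsualConditions P 𝓕) (hW : IsFBrownian P 𝓕 W) (hy : y ≤ p.ybar)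
    (hI : Admissible P 𝓕 p y I) (x : ℝ) : IsPrice P 𝓕 W p x y I (price P 𝓕 W p x y I) := by
  obtain ⟨I', h1, h2, h3⟩ := hI.exists_regular h𝓕 hy
  obtain ⟨W', h4, h5, h6⟩ := hW.exists_regular h𝓕
  have h : ∃ X, IsPrice P 𝓕 W p x y I X := ⟨_, isPrice_pricePath h1 h2 h4 h5.continuous h3 h6⟩
  rw [price, dif_pos h]
  exact h.choose_spec

theorem ae_revenueRate_eq (h𝓕 : UsualConditions P 𝓕) (hW : IsFBrownian P 𝓕 W) (hy : y ≤ p.ybar)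
    (hI : Admissible P 𝓕 p y I) (x : ℝ) : ∀ᵐ ω ∂P, revenueRate P 𝓕 W p x y I ω =
      pathRevenueRate p x y (fun t => I t ω) (fun t => W t ω) := by
  filter_upwards [(isPrice_price h𝓕 hW hy hI x).ae_eq_pricePath hI hW.brownian.cont] with ω h
  ext t
  rw [revenueRate, h, pathRevenueRate]

theorem ae_netProfit_eq (h𝓕 : UsualConditions P 𝓕) (hW : IsFBrownian P 𝓕 W) (hy : y ≤ p.ybar)
    (hI : Admissible P 𝓕 p y I) (x : ℝ) : ∀ᵐ ω ∂P, netProfit P 𝓕 W p x y I ω =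
      pathNetProfit p x y (fun t => I t ω) (fun t => W t ω) := by
  filter_upwards [ae_revenueRate_eq h𝓕 hW hy hI x] with ω h
  rw [netProfit, h, pathNetProfit]

theorem measurable_discountedInstallation {C ρ : ℝ} (hρ : 0 < ρ) (hIm : ∀ t, Measurable (I t))
    (hI : ∀ ω, IsInstallPath C fun t => I t ω) :
    Measurable fun ω => discountedInstallation ρ fun t => I t ω := by
  have h1 := measurable_uncurry_of_rightContinuous hIm fun ω => (hI ω).rightContinuous
  have h2 : Measurable (Function.uncurry fun ω (u : ℝ) =>
      ρ * Real.exp (-ρ * u) * I u.toNNReal ω) :=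
    ((Real.measurable_exp.comp (measurable_snd.const_mul _)).const_mul ρ).mul
      (h1.comp (measurable_fst.prodMk (measurable_real_toNNReal.comp measurable_snd)))
  simp only [fun ω => (hI ω).discountedInstallation_eq hρ]
  exact (h2.stronglyMeasurable.integral_prod_right).measurable

theorem integrable_discountedInstallation {C ρ : ℝ} (hρ : 0 < ρ) (hIm : ∀ t, Measurable (I t))
    (hI : ∀ ω, IsInstallPath C fun t => I t ω) :
    Integrable (fun ω => discountedInstallation ρ fun t => I t ω) P :=
  .mono' (integrable_const C) (measurable_discountedInstallation hρ hIm hI).aestronglyMeasurable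
    (.of_forall fun ω => by
      rw [Real.norm_of_nonneg ((hI ω).discountedInstallation_nonneg hρ)]
      exact (hI ω).discountedInstallation_le hρ)

/-- The standing sign conditions on the parameters. -/
structure Params.Valid (p : Params) : Prop where
  κ_pos : 0 < p.κ
  σ_pos : 0 < p.σ
  β_pos : 0 < p.β
  ρ_pos : 0 < p.ρ
  c_nonneg : 0 ≤ p.c
  ybar_nonneg : 0 ≤ p.ybar

theorem profitWellDefined (h𝓕 : UsualConditions P 𝓕) (hW : IsFBrownian P 𝓕 W) (hp : p.Valid)
    (hy : y ∈ Icc 0 p.ybar) (hI : Admissible P 𝓕 p y I) (x : ℝ) :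
    ProfitWellDefined P 𝓕 W p x y I := by
  have hX := isPrice_price h𝓕 hW hy.2 hI x
  obtain ⟨I', h1, h2, h3⟩ := hI.exists_regular h𝓕 hy.2
  obtain ⟨W', h4, h5, h6⟩ := hW.exists_regular h𝓕
  have hm : ∀ t, Measurable (I' t) := fun t => ((h1 t).mono (𝓕.le t)).measurable
  have hi := integrable_pathRevenueRate (x := x) h5 hp.κ_pos hp.σ_pos hp.β_pos hp.ρ_pos hy hm h2
  refine ⟨hX, fun X hX' => ?_, ?_, ?_, ?_, ?_⟩
  · filter_upwards [hX.ae_eq_pricePath hI hW.brownian.cont,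
      hX'.ae_eq_pricePath hI hW.brownian.cont] with ω ha hb t
    rw [ha, hb]
  · filter_upwards [hi.prod_right_ae, ae_revenueRate_eq h𝓕 hW hy.2 hI x, h3, h6]
      with ω ha hb hc hd
    rw [hb, ← hc, ← hd]
    exact ha
  · filter_upwards [hI.ae_isInstallPath] with ω h using h.monotone_extendByZero
  · filter_upwards [hI.ae_isInstallPath] with ω h using h.integrableOn_exp hp.ρ_pos
  · refine (hi.integral_prod_left.sub
      ((integrable_discountedInstallation hp.ρ_pos hm h2).const_mul p.c)).congr ?_
    filter_upwards [ae_netProfit_eq h𝓕 hW hy.2 hI x, h3, h6] with ω hb hc hd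
    rw [hb, ← hc, ← hd]
    rfl

/-- Pathwise: the price increases with `x`, its factor `y + I` is nonnegative, and the cost does not
involve `x`. -/
theorem expectedProfit_mono (h𝓕 : UsualConditions P 𝓕) (hW : IsFBrownian P 𝓕 W) (hp : p.Valid)
    (hy : y ∈ Icc 0 p.ybar) (hI : Admissible P 𝓕 p y I) :
    Monotone fun x => expectedProfit P 𝓕 W p x y I := by
  intro x x' hx
  have h := profitWellDefined h𝓕 hW hp hy hI x
  have h' := profitWellDefined h𝓕 hW hp hy hI x'
  refine integral_mono_ae h.expectation h'.expectation ?_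
  filter_upwards [h.revenue, h'.revenue, ae_revenueRate_eq h𝓕 hW hy.2 hI x,
    ae_revenueRate_eq h𝓕 hW hy.2 hI x'] with ω h1 h2 h3 h4
  refine sub_le_sub_right (setIntegral_mono_on h1 h2 measurableSet_Ioi fun t _ => ?_) _
  rw [h3, h4]
  exact mul_le_mul_of_nonneg_right (mul_le_mul_of_nonneg_left (pricePath_mono p y _ _ _ hx)
    (Real.exp_pos _).le) (add_nonneg hy.1 (hI.nonneg _ _))

/-- The expected profit grows at most linearly, uniformly over the strategies. -/
theorem exists_abs_expectedProfit_le (h𝓕 : UsualConditions P 𝓕)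
    (hW : IsFBrownian P 𝓕 W) (hp : p.Valid) :
    ∃ K : ℝ, 0 < K ∧ ∀ x : ℝ, ∀ y ∈ Icc 0 p.ybar, ∀ I, Admissible P 𝓕 p y I →
      |expectedProfit P 𝓕 W p x y I| ≤ K * (1 + |x|) := by
  obtain ⟨W', h4, h5, h6⟩ := hW.exists_regular h𝓕
  have hb := h5.integrable_priceBound hp.κ_pos hp.σ_pos hp.β_pos hp.ρ_pos hp.ybar_nonneg
  set B : ℝ := ∫ q, Real.exp (-p.ρ * q.2) * priceBound p (fun t => W' t q.1) q.2
    ∂(P.prod (volume.restrict (Ioi 0))) with hB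
  have hK : 0 ≤ p.ybar / p.ρ := div_nonneg hp.ybar_nonneg hp.ρ_pos.le
  have hK' : 0 ≤ p.ybar * |B| := mul_nonneg hp.ybar_nonneg (abs_nonneg _)
  have hK'' : 0 ≤ p.c * p.ybar := mul_nonneg hp.c_nonneg hp.ybar_nonneg
  -- The summands come from the initial value, the noise and the installation cost; the `1` ensures
  -- positivity even if `ybar = 0`.
  refine ⟨p.ybar / p.ρ + p.ybar * |B| + p.c * p.ybar + 1, by positivity, fun x y hy I hI => ?_⟩
  obtain ⟨I', h1, h2, h3⟩ := hI.exists_regular h𝓕 hy.2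
  have hm : ∀ t, Measurable (I' t) := fun t => ((h1 t).mono (𝓕.le t)).measurable
  have hi := integrable_pathRevenueRate (x := x) h5 hp.κ_pos hp.σ_pos hp.β_pos hp.ρ_pos hy hm h2
  have hci := integrable_discountedInstallation (P := P) hp.ρ_pos hm h2
  have he : expectedProfit P 𝓕 W p x y I =
      (∫ q, pathRevenueRate p x y (fun t => I' t q.1) (fun t => W' t q.1) q.2
        ∂(P.prod (volume.restrict (Ioi 0)))) -
      p.c * ∫ ω, discountedInstallation p.ρ (fun t => I' t ω) ∂P := by
    rw [integral_prod _ hi, ← integral_const_mul, ← integral_sub hi.integral_prod_left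
      (hci.const_mul p.c)]
    refine integral_congr_ae ?_
    filter_upwards [ae_netProfit_eq h𝓕 hW hy.2 hI x, h3, h6] with ω hb hc hd
    rw [hb, ← hc, ← hd, pathNetProfit]
  have h7 : |∫ q, pathRevenueRate p x y (fun t => I' t q.1) (fun t => W' t q.1) q.2
      ∂(P.prod (volume.restrict (Ioi 0)))| ≤ p.ybar * (|x| / p.ρ + B) := by
    have hs : Integrable (fun q : Ω × ℝ => |x| * Real.exp (-p.ρ * q.2))
        (P.prod (volume.restrict (Ioi 0))) :=
      Integrable.comp_snd ((integrableOn_exp_neg_mul hp.ρ_pos 0).const_mul |x|) P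
    have hsi : ∫ q, |x| * Real.exp (-p.ρ * q.2) ∂(P.prod (volume.restrict (Ioi 0))) =
        |x| / p.ρ := by
      rw [integral_prod _ hs]
      simp only [integral_const_mul, integral_exp_neg_mul_Ioi hp.ρ_pos]
      simp [div_eq_mul_inv]
    have h0 : ∀ᵐ q : Ω × ℝ ∂P.prod (volume.restrict (Ioi 0)), q.2 ∈ Ioi (0 : ℝ) :=
      Measure.quasiMeasurePreserving_snd.ae (ae_restrict_mem measurableSet_Ioi)
    rw [hB, ← hsi, ← integral_add hs hb, ← integral_const_mul, ← Real.norm_eq_abs]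
    refine norm_integral_le_of_norm_le ((hs.add hb).const_mul p.ybar) ?_
    filter_upwards [h0] with q hq
    exact abs_pathRevenueRate_le hp.κ_pos hp.σ_pos hp.β_pos hy (h2 q.1) (h5.continuous q.1)
      (le_of_lt hq)
  have h8 : 0 ≤ ∫ ω, discountedInstallation p.ρ (fun t => I' t ω) ∂P :=
    integral_nonneg fun ω => (h2 ω).discountedInstallation_nonneg hp.ρ_pos
  have h9 : ∫ ω, discountedInstallation p.ρ (fun t => I' t ω) ∂P ≤ p.ybar := by
    calc _ ≤ ∫ _, p.ybar ∂P := integral_mono hci (integrable_const _) fun ω =>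
          ((h2 ω).discountedInstallation_le hp.ρ_pos).trans (by linarith [hy.1])
      _ = p.ybar := by simp
  have h10 : p.ybar * (|x| / p.ρ + B) ≤ p.ybar / p.ρ * |x| + p.ybar * |B| := by
    have := mul_le_mul_of_nonneg_left (le_abs_self B) hp.ybar_nonneg
    calc _ = p.ybar / p.ρ * |x| + p.ybar * B := by ring
      _ ≤ _ := by linarith
  have h11 := mul_nonneg hp.c_nonneg h8
  have h12 := mul_le_mul_of_nonneg_left h9 hp.c_nonneg
  rw [he]
  refine (abs_sub _ _).trans ?_
  rw [abs_of_nonneg h11]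
  nlinarith [abs_nonneg x, mul_nonneg hK' (abs_nonneg x), mul_nonneg hK'' (abs_nonneg x)]

theorem noInstallProfit_eq (h𝓕 : UsualConditions P 𝓕) (hW : IsFBrownian P 𝓕 W) (hp : p.Valid)
    (hy : y ∈ Icc 0 p.ybar) (x : ℝ) : noInstallProfit P 𝓕 W p x y =
      x * y / (p.ρ + p.κ) + p.μ * p.κ * y / (p.ρ * (p.ρ + p.κ))
        - p.κ * p.β * y ^ 2 / (p.ρ * (p.ρ + p.κ)) := by
  obtain ⟨W', h4, h5, h6⟩ := hW.exists_regular h𝓕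
  have hz := isInstallPath_zero (sub_nonneg.2 hy.2)
  have hi := integrable_pathRevenueRate (P := P) (x := x) (I := fun _ _ => 0) h5 hp.κ_pos hp.σ_pos
    hp.β_pos hp.ρ_pos hy (fun _ => measurable_const) (fun _ => hz)
  have hd : discountedInstallation p.ρ (fun _ => 0) = 0 := by
    rw [hz.discountedInstallation_eq hp.ρ_pos]
    simp
  have h1 : noInstallProfit P 𝓕 W p x y = ∫ ω, (∫ t in Ioi (0 : ℝ),
      pathRevenueRate p x y (fun _ => 0) (fun t => W' t ω) t) ∂P := by
    refine integral_congr_ae ?_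
    filter_upwards [ae_netProfit_eq h𝓕 hW hy.2 (admissible_zero hy.2) x, h6] with ω ha hb
    rw [ha, ← hb]
    simp only [pathNetProfit, Pi.zero_apply, hd, mul_zero, sub_zero]
  have hρκ : 0 < p.ρ + p.κ := add_pos hp.ρ_pos hp.κ_pos
  -- The transient part of the mean price decays at rate `κ`, hence the discount rates `ρ + κ` and
  -- `ρ`.
  have h2 : ∀ t ∈ Ioi (0 : ℝ),
      ∫ ω, pathRevenueRate p x y (fun _ => 0) (fun t => W' t ω) t ∂P =
      y * (x - (p.μ - p.β * y)) * Real.exp (-(p.ρ + p.κ) * t) +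
        y * (p.μ - p.β * y) * Real.exp (-p.ρ * t) := fun t ht => by
    simp only [pathRevenueRate, add_zero]
    rw [integral_mul_const, integral_const_mul, integral_pricePath_zero h5 hp.κ_pos hp.σ_pos,
      Real.coe_toNNReal t (le_of_lt ht), show -(p.ρ + p.κ) * t = -p.ρ * t + -p.κ * t by ring,
      Real.exp_add]
    ring
  rw [h1, integral_integral_swap hi, setIntegral_congr_fun measurableSet_Ioi h2,
    integral_add ((integrableOn_exp_neg_mul hρκ 0).const_mul _)
      ((integrableOn_exp_neg_mul hp.ρ_pos 0).const_mul _), integral_const_mul, integral_const_mul,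
    integral_exp_neg_mul_Ioi hρκ, integral_exp_neg_mul_Ioi hp.ρ_pos]
  have := hp.ρ_pos
  simp only [mul_zero, Real.exp_zero]
  field_simp
  ring

/-- At full capacity only the trivial strategy is admissible. -/
theorem expectedProfit_eq_noInstallProfit (h𝓕 : UsualConditions P 𝓕) (hW : IsFBrownian P 𝓕 W)
    (hI : Admissible P 𝓕 p p.ybar I) (x : ℝ) :
    expectedProfit P 𝓕 W p x p.ybar I = noInstallProfit P 𝓕 W p x p.ybar := by
  refine integral_congr_ae ?_
  filter_upwards [ae_netProfit_eq h𝓕 hW le_rfl hI x,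
    ae_netProfit_eq h𝓕 hW le_rfl (admissible_zero le_rfl) x, hI.le_capacity] with ω h1 h2 h3
  have h4 : ∀ t, I t ω = (0 : ℝ≥0 → Ω → ℝ) t ω := fun t =>
    le_antisymm ((h3 t).trans (sub_self _).le) (hI.nonneg t ω)
  rw [h1, h2]
  simp only [h4]

end

/-! ### Passage to the supremum -/

theorem proposition3p1 {Ω : Type*} {mΩ : MeasurableSpace Ω} (P : Measure Ω)
    [IsProbabilityMeasure P] (𝓕 : Filtration ℝ≥0 mΩ) (h𝓕 : UsualConditions P 𝓕)
    (W : ℝ≥0 → Ω → ℝ) (hW : IsFBrownian P 𝓕 W)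
    (p : Params) (hκ : 0 < p.κ) (hσ : 0 < p.σ) (hβ : 0 < p.β) (hρ : 0 < p.ρ) (hc : 0 ≤ p.c)
    (hybar : 0 ≤ p.ybar) :
    -- The profits are well defined, and `V` is a genuine (finite) supremum.
    (∀ x : ℝ, ∀ y ∈ Icc 0 p.ybar,
      (∀ I, Admissible P 𝓕 p y I → ProfitWellDefined P 𝓕 W p x y I) ∧
      IsLUB (attainableProfits P 𝓕 W p x y) (valueFn P 𝓕 W p x y)) ∧
    -- `V` grows at most linearly.
    (∃ K : ℝ, 0 < K ∧ ∀ x : ℝ, ∀ y ∈ Icc 0 p.ybar,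
      |valueFn P 𝓕 W p x y| ≤ K * (1 + |x|)) ∧
    -- `V(x, ybar) = R(x, ybar)`, where `R` has the following explicit form.
    (∀ x : ℝ, valueFn P 𝓕 W p x p.ybar = noInstallProfit P 𝓕 W p x p.ybar) ∧
    (∀ x : ℝ, ∀ y ∈ Icc 0 p.ybar, noInstallProfit P 𝓕 W p x y =
      x * y / (p.ρ + p.κ) + p.μ * p.κ * y / (p.ρ * (p.ρ + p.κ))
        - p.κ * p.β * y ^ 2 / (p.ρ * (p.ρ + p.κ))) ∧
    -- `V` is nondecreasing in `x`.
    (∀ y ∈ Icc 0 p.ybar, Monotone fun x => valueFn P 𝓕 W p x y) := by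
  have hp : p.Valid := ⟨hκ, hσ, hβ, hρ, hc, hybar⟩
  obtain ⟨K, hK, hKb⟩ := exists_abs_expectedProfit_le h𝓕 hW hp
  have hmem : ∀ x, ∀ y ∈ Icc 0 p.ybar,
      noInstallProfit P 𝓕 W p x y ∈ attainableProfits P 𝓕 W p x y :=
    fun x y hy => ⟨0, admissible_zero hy.2, rfl⟩
  have hLUB : ∀ x, ∀ y ∈ Icc 0 p.ybar,
      IsLUB (attainableProfits P 𝓕 W p x y) (valueFn P 𝓕 W p x y) := fun x y hy => by
    refine isLUB_csSup ⟨_, hmem x y hy⟩ ⟨K * (1 + |x|), ?_⟩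
    rintro _ ⟨I, hI, rfl⟩
    exact (abs_le.1 (hKb x y hy I hI)).2
  refine ⟨fun x y hy => ⟨fun I hI => profitWellDefined h𝓕 hW hp hy hI x, hLUB x y hy⟩,
    ⟨K, hK, fun x y hy => abs_le.2 ⟨?_, ?_⟩⟩, fun x => ?_,
    fun x y hy => noInstallProfit_eq h𝓕 hW hp hy x, fun y hy x x' hx => ?_⟩
  -- The lower bound comes from never installing.
  · exact (abs_le.1 (hKb x y hy 0 (admissible_zero hy.2))).1.trans
      ((hLUB x y hy).1 (hmem x y hy))
  · refine (hLUB x y hy).2 ?_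
    rintro _ ⟨I, hI, rfl⟩
    exact (abs_le.1 (hKb x y hy I hI)).2
  · refine le_antisymm ((hLUB x _ ⟨hybar, le_rfl⟩).2 ?_)
      ((hLUB x _ ⟨hybar, le_rfl⟩).1 (hmem x _ ⟨hybar, le_rfl⟩))
    rintro _ ⟨I, hI, rfl⟩
    exact (expectedProfit_eq_noInstallProfit h𝓕 hW hI x).le
  · refine (hLUB x y hy).2 ?_
    rintro _ ⟨I, hI, rfl⟩
    -- A strategy admissible for `x` is admissible for `x'` too, and earns at least as much there.
    exact (expectedProfit_mono h𝓕 hW hp hy hI hx).trans ((hLUB x' y hy).1 ⟨I, hI, rfl⟩)
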